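/- Let $J\subset\mathbb R$ be a bounded interval and let $p:J\to\mathbb R$ satisfy $1<\inf_J p\le\sup_J p<\infty$ and the local log-Hölder condition on $J$: there is $C>0$ such that $|p(x)-p(y)|\le \frac{C}{-\ln|x-y|}$ for all $x,y\in J$ with $0<|x-y|\le \frac12$. Let $0\le\alpha<1$ and let $v:J\to[0,\infty)$ be a measurable weight function. For measurable $g$ on $J$ put $$\|g\|_{L^{p(\cdot)}(J)}=\inf\Big\{\lambda>0:\ \int_J\Big(\frac{|g(x)|}{\lambda}\Big)^{p(x)}dx\le1\Big\},$$ and let $L^{p(\cdot)}(J)$ be the class of measurable $f$ on $J$ with $\int_J|f(x)|^{p(x)}dx<\infty$. For $x\in J$ let $$(M^{(J)}_\alpha f)(x)=\sup_{I\ni x,\ I\subset J}\frac1{|I|^{1-\alpha}}\int_I|f(y)|\,dy,$$ where, here and below, $I$ runs over the intervals of positive length $|I|$. Then there is a finite constant $c$ such that the trace inequality $$\|v\,M^{(J)}_\alpha f\|_{L^{p(\cdot)}(J)}\le c\,\|f\|_{L^{p(\cdot)}(J)}$$ holds for all $f\in L^{p(\cdot)}(J)$ if and only if $$\sup_{I\subset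 J}\ \frac1{|I|}\int_I v(x)^{p(x)}|I|^{\alpha p(x)}\,dx<\infty .$$ -/

import Mathlib

open MeasureTheory
open scoped ENNReal NNReal

noncomputable section

namespace VarExp

/-- `I` is a subinterval of `J` of positive length (open, closed or half-open). -/
def IsSubinterval (I J : Set ℝ) : Prop :=
  I.OrdConnected ∧ I.Nontrivial ∧ I ⊆ J

/-- `p_-(E)`, the infimum of `p` over `E`, in the extended reals. -/
def expMinus (p : ℝ → ℝ) (E : Set ℝ) : EReal := ⨅ x ∈ E, (p x : EReal)

/-- `p_+(E)`, the supremum of `p` over `E`, in the extended reals. -/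
def expPlus (p : ℝ → ℝ) (E : Set ℝ) : EReal := ⨆ x ∈ E, (p x : EReal)

/-- The local log-Hölder condition on `J`. For `x = y` both sides are `0`. -/
def LogHolderOn (p : ℝ → ℝ) (J : Set ℝ) : Prop :=
  ∃ c : ℝ, 0 < c ∧ ∀ x ∈ J, ∀ y ∈ J, |x - y| ≤ 1 / 2 →
    |p x - p y| ≤ c / (-Real.log |x - y|)

/-- The modular `S_p(g) = ∫_J g(x)^{p(x)} dx` of a function with values in `[0, ∞]`. -/
def modular (p : ℝ → ℝ) (J : Set ℝ) (g : ℝ → ℝ≥0∞) : ℝ≥0∞ :=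
  ∫⁻ x in J, g x ^ p x

/-- The Luxemburg norm `inf {l > 0 : S_p(g / l) ≤ 1}` of `L^{p(·)}(J)`, evaluated at a function
with values in `[0, ∞]`; it is `∞` if there is no such `l`. -/
def luxNorm (p : ℝ → ℝ) (J : Set ℝ) (g : ℝ → ℝ≥0∞) : ℝ≥0∞ :=
  ⨅ (l : ℝ≥0) (_ : 0 < l) (_ : modular p J (fun x => g x / (l : ℝ≥0∞)) ≤ 1), (l : ℝ≥0∞)

/-- Membership in `L^{p(·)}(J)`. -/
def MemVarLp (p : ℝ → ℝ) (J : Set ℝ) (f : ℝ → ℝ) : Prop :=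
  AEMeasurable f (volume.restrict J) ∧ modular p J (fun x => ‖f x‖ₑ) < ∞

/-- The fractional maximal function
`(M_α^{(J)} f)(x) = sup_{x ∈ I ⊆ J} |I|^{-(1-α)} ∫_I |f(y)| dy`. -/
def fracMaximal (J : Set ℝ) (α : ℝ) (f : ℝ → ℝ) (x : ℝ) : ℝ≥0∞ :=
  ⨆ (I : Set ℝ) (_ : IsSubinterval I J) (_ : x ∈ I),
    (volume I ^ (1 - α))⁻¹ * ∫⁻ y in I, ‖f y‖ₑ

end VarExp

end

/-! Sufficiency. Scale so that `F` has modular at most `1`, take `1 < s ≤ p` on `J` and put `h = 1 +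
F ^ (p / s)`. The log-Hölder condition keeps `|I| ^ (p y - p x)` bounded for `x, y ∈ I`, so Jensen's
inequality survives a variable exponent: `(avg I F) ^ p x ≤ K (avg I h) ^ s`
(`avg_rpow_le_mul_avg_rpow`). If `avg I h` lies in `[2^k, 2^(k+1))`, then `I` lies inside a
component `R` of the superlevel set `O_k` of averages of `h`, and `|I| ^ α ≤ |R| ^ α`. Hence `(v M_α
F) ^ p` is dominated by a sum over `k` of `2^(ks) v ^ p |R| ^ (α p)` on `O_k`
(`mul_eFracMaximal_rpow_le`). The testing condition on each `R` bounds its integral by `B |R|`, and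
adding up the components leaves `∑ 2^(ks) |O_k|`, which the constant exponent maximal theorem
(`tsum_volume_superlevel_le`) controls by `∫ h ^ s ≤ 2^(s-1) (|J| + 1)`. Homogeneity turns this
modular bound into the norm inequality.

Necessity. Test on the indicator of `I`: its maximal function is at least `|I| ^ α` on `I`, and by
log-Hölder its norm is at most a constant times `|I| ^ (1 / p x₀)` for any `x₀ ∈ I`, while `|I| ^ (p
x / p x₀)` is comparable to `|I|` (`rpow_div_le_mul`). -/

namespace VarExp

section Interval

variable {I J : Set ℝ} {x y : ℝ}

theorem ofReal_abs_sub_le_volume (hI : I.OrdConnected) (hx : x ∈ I) (hy : y ∈ I) :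
    ENNReal.ofReal |x - y| ≤ volume I := by
  rw [abs_sub_comm, ← Real.volume_interval]
  exact measure_mono (hI.uIcc_subset hx hy)

theorem volume_pos_of_ordConnected (hI : I.OrdConnected) (hn : I.Nontrivial) : 0 < volume I := by
  obtain ⟨x, hx, y, hy, hxy⟩ := hn
  refine lt_of_lt_of_le ?_ (ofReal_abs_sub_le_volume hI hx hy)
  simpa [sub_eq_zero] using hxy

theorem interior_nonempty_of_ordConnected (hI : I.OrdConnected) (hn : I.Nontrivial) :
    (interior I).Nonempty := by
  obtain ⟨x, hx, y, hy, hxy⟩ := hn.exists_lt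
  exact (Set.nonempty_Ioo.2 hxy).mono
    (interior_maximal (Set.Ioo_subset_Icc_self.trans (hI.out hx hy)) isOpen_Ioo)

theorem IsSubinterval.volume_pos (h : IsSubinterval I J) : 0 < volume I :=
  volume_pos_of_ordConnected h.1 h.2.1

theorem IsSubinterval.volume_le (h : IsSubinterval I J) : volume I ≤ volume J :=
  measure_mono h.2.2

theorem IsSubinterval.measurableSet (h : IsSubinterval I J) : MeasurableSet I :=
  h.1.measurableSet

end Interval

/-! ### Unions of intervals and their components -/

/-- `O` is a union of intervals of positive length. -/
def IsIntervalUnion (O : Set ℝ) : Prop :=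
  ∀ x ∈ O, ∃ I : Set ℝ, x ∈ I ∧ I.OrdConnected ∧ I.Nontrivial ∧ I ⊆ O

namespace IsIntervalUnion

variable {O : Set ℝ}

theorem nontrivial_component (hO : IsIntervalUnion O) {x : ℝ} (hx : x ∈ O) :
    (O.ordConnectedComponent x).Nontrivial := by
  obtain ⟨I, hxI, hI, hn, hsubO⟩ := hO x hx
  exact hn.mono (Set.subset_ordConnectedComponent hxI hsubO)

theorem component_eq {x y : ℝ} (h : y ∈ O.ordConnectedComponent x) :
    O.ordConnectedComponent y = O.ordConnectedComponent x :=
  (Set.ordConnectedComponent_eq h).symm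

theorem pairwiseDisjoint_components :
    (O.ordConnectedComponent '' O).PairwiseDisjoint id := by
  rintro _ ⟨x, -, rfl⟩ _ ⟨y, -, rfl⟩ hne
  refine Set.disjoint_left.2 fun z hzx hzy => hne ?_
  rw [← component_eq hzx, ← component_eq hzy]

/-- Disjoint sets with nonempty interior are countably many in a separable space. -/
theorem countable_components (hO : IsIntervalUnion O) :
    (O.ordConnectedComponent '' O).Countable := by
  refine pairwiseDisjoint_components.countable_of_nonempty_interior ?_
  rintro _ ⟨x, hx, rfl⟩
  have : (O.ordConnectedComponent x).OrdConnected := inferInstance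
  exact interior_nonempty_of_ordConnected this (hO.nontrivial_component hx)

theorem biUnion_components : ⋃ R ∈ O.ordConnectedComponent '' O, id R = O := by
  refine Set.Subset.antisymm (Set.iUnion₂_subset ?_) fun x hx => ?_
  · rintro _ ⟨x, -, rfl⟩
    exact Set.ordConnectedComponent_subset
  · exact Set.mem_biUnion (Set.mem_image_of_mem _ hx) (Set.self_mem_ordConnectedComponent.2 hx)

theorem measurableSet_components {R : Set ℝ} (hR : R ∈ O.ordConnectedComponent '' O) :
    MeasurableSet (id R) := by
  obtain ⟨x, -, rfl⟩ := hR
  have : (O.ordConnectedComponent x).OrdConnected := inferInstance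
  exact this.measurableSet

theorem measurableSet (hO : IsIntervalUnion O) : MeasurableSet O := by
  rw [← biUnion_components (O := O)]
  exact MeasurableSet.biUnion hO.countable_components fun R hR => measurableSet_components hR

theorem measurable_volume_component (hO : IsIntervalUnion O) :
    Measurable fun x => volume (O.ordConnectedComponent x) := by
  -- The length is constant on each component, so the set where it exceeds `t` is again a union of
  -- components.
  refine measurable_of_Ioi fun t => IsIntervalUnion.measurableSet fun x hx => ?_
  have hxO : x ∈ O := by
    by_contra h
    rw [Set.mem_preimage, Set.ordConnectedComponent_eq_empty.2 h] at hx
    simp at hx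
  refine ⟨O.ordConnectedComponent x, Set.self_mem_ordConnectedComponent.2 hxO, inferInstance,
    hO.nontrivial_component hxO, fun y hy => ?_⟩
  rw [Set.mem_preimage, component_eq hy]
  exact hx

/-- Integrating over a union of intervals component by component. -/
theorem lintegral_le (hO : IsIntervalUnion O) (φ : ℝ → ℝ≥0∞ → ℝ≥0∞) (B : ℝ≥0∞)
    (h : ∀ x ∈ O, ∫⁻ y in O.ordConnectedComponent x, φ y (volume (O.ordConnectedComponent x)) ≤
      B * volume (O.ordConnectedComponent x)) :
    ∫⁻ y in O, φ y (volume (O.ordConnectedComponent y)) ≤ B * volume O := by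
  have hU := biUnion_components (O := O)
  have hv : volume O = ∑' R : (O.ordConnectedComponent '' O), volume (id R.1) := by
    conv_lhs => rw [← hU]
    exact measure_biUnion hO.countable_components pairwiseDisjoint_components
      fun R hR => measurableSet_components hR
  have hi : ∫⁻ y in O, φ y (volume (O.ordConnectedComponent y)) =
      ∑' R : (O.ordConnectedComponent '' O),
        ∫⁻ y in id R.1, φ y (volume (O.ordConnectedComponent y)) := by
    conv_lhs => rw [← hU]
    rw [lintegral_biUnion hO.countable_components (fun R hR => measurableSet_components hR)
      pairwiseDisjoint_components]
    simp only [hU]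
  rw [hi, hv, ← ENNReal.tsum_mul_left]
  refine ENNReal.tsum_le_tsum ?_
  rintro ⟨R, hR⟩
  obtain ⟨x, hx, hxR⟩ := id hR
  have hm := measurableSet_components hR
  subst hxR
  refine le_trans (le_of_eq ?_) (h x hx)
  refine setLIntegral_congr_fun hm fun y hy => ?_
  simp only [component_eq hy]

end IsIntervalUnion

/-! ### The maximal theorem for a constant exponent -/

/-- The set where the average of `g` over some subinterval of `J` is at least `t`. -/
def superlevel (J : Set ℝ) (g : ℝ → ℝ≥0∞) (t : ℝ≥0∞) : Set ℝ :=
  ⋃ (I : Set ℝ) (_ : IsSubinterval I J ∧ t * volume I ≤ ∫⁻ y in I, g y), I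

section Maximal

variable {J : Set ℝ} {g h : ℝ → ℝ≥0∞} {t : ℝ≥0∞}

theorem subset_superlevel {I : Set ℝ} (hI : IsSubinterval I J)
    (ht : t * volume I ≤ ∫⁻ y in I, g y) : I ⊆ superlevel J g t :=
  Set.subset_iUnion₂_of_subset I ⟨hI, ht⟩ subset_rfl

theorem superlevel_subset : superlevel J g t ⊆ J :=
  Set.iUnion₂_subset fun _ hI => hI.1.2.2

theorem isIntervalUnion_superlevel : IsIntervalUnion (superlevel J g t) := by
  intro x hx
  obtain ⟨I, hI, hxI⟩ := Set.mem_iUnion₂.1 hx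
  exact ⟨I, hxI, hI.1.1, hI.1.2.1, subset_superlevel hI.1 hI.2⟩

/-- The weak type `(1, 1)` inequality. -/
theorem mul_volume_superlevel_le (hJ : volume J ≠ ∞) :
    t * volume (superlevel J g t) ≤ 6 * ∫⁻ y in J, g y := by
  obtain ⟨u, hut, hdisj, hcov⟩ := Vitali.exists_disjoint_subfamily_covering_enlargement
    (fun I : Set ℝ => I) {I | IsSubinterval I J ∧ t * volume I ≤ ∫⁻ y in I, g y}
    (fun I => (volume I).toReal) 2 one_lt_two (fun _ _ => ENNReal.toReal_nonneg)
    (volume J).toReal (fun I hI => ENNReal.toReal_mono hJ hI.1.volume_le)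
    (fun I hI => hI.1.2.1.nonempty)
  have hcount : u.Countable := hdisj.countable_of_nonempty_interior fun I hI =>
    interior_nonempty_of_ordConnected (hut hI).1.1 (hut hI).1.2.1
  have hfin : ∀ I ∈ {I | IsSubinterval I J ∧ t * volume I ≤ ∫⁻ y in I, g y}, volume I ≠ ∞ :=
    fun I hI => ne_top_of_le_ne_top hJ hI.1.volume_le
  choose! c hc using fun I (hI : I ∈ u) => (hut hI).1.2.1.nonempty
  -- An interval `A` meets a selected `I` with `|A| ≤ 2 |I|`, so it stays within `2 |I| + |I|` of
  -- any point of `I`; the balls have length `6 |I|`.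
  have hsub : superlevel J g t ⊆ ⋃ I ∈ u, Metric.closedBall (c I) (3 * (volume I).toReal) := by
    refine Set.iUnion₂_subset fun A hA y hy => ?_
    obtain ⟨I, hIu, ⟨z, hzA, hzI⟩, hAI⟩ := hcov A hA
    refine Set.mem_biUnion hIu ?_
    have h1 := (ENNReal.ofReal_le_iff_le_toReal (hfin A hA)).1
      (ofReal_abs_sub_le_volume hA.1.1 hy hzA)
    have h2 := (ENNReal.ofReal_le_iff_le_toReal (hfin I (hut hIu))).1
      (ofReal_abs_sub_le_volume (hut hIu).1.1 hzI (hc I hIu))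
    have h3 := abs_sub_le y z (c I)
    rw [Metric.mem_closedBall, Real.dist_eq]
    linarith
  calc t * volume (superlevel J g t)
      ≤ t * ∑' I : u, volume (Metric.closedBall (c I.1) (3 * (volume I.1).toReal)) := by
        gcongr
        exact (measure_mono hsub).trans (measure_biUnion_le _ hcount _)
    _ = ∑' I : u, 6 * (t * volume I.1) := by
        rw [← ENNReal.tsum_mul_left]
        refine tsum_congr fun I => ?_
        rw [Real.volume_closedBall, ← mul_assoc, ENNReal.ofReal_mul (by norm_num),
          ENNReal.ofReal_toReal (hfin I.1 (hut I.2))]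
        norm_num
        ring
    _ ≤ ∑' I : u, 6 * ∫⁻ y in I.1, g y := by
        refine ENNReal.tsum_le_tsum fun I => ?_
        gcongr
        exact (hut I.2).2
    _ = 6 * ∫⁻ y in ⋃ I ∈ u, I, g y := by
        rw [ENNReal.tsum_mul_left,
          lintegral_biUnion hcount (fun I hI => (hut hI).1.measurableSet) hdisj]
    _ ≤ 6 * ∫⁻ y in J, g y := by
        gcongr
        exact Set.iUnion₂_subset fun I hI => (hut hI).1.2.2

/-- Values of `g` below `t / 2` contribute at most `t / 2` to an average, so the large values alone
average at least `t / 2`; the weak type bound applies to them. -/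
theorem half_mul_volume_superlevel_le (hJ : volume J ≠ ∞) (ht : t ≠ ∞) :
    t * volume (superlevel J g t) ≤ 12 * ∫⁻ y in J, {y | t ≤ 2 * g y}.indicator g y := by
  have hsub : superlevel J g t ⊆ superlevel J ({y | t ≤ 2 * g y}.indicator g) (t / 2) := by
    refine Set.iUnion₂_subset fun I hI => subset_superlevel hI.1 ?_
    have hIfin : volume I ≠ ∞ := ne_top_of_le_ne_top hJ hI.1.volume_le
    have hle : ∫⁻ y in I, g y ≤
        (∫⁻ y in I, {y | t ≤ 2 * g y}.indicator g y) + t / 2 * volume I := by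
      rw [← setLIntegral_const, ← lintegral_add_right _ measurable_const]
      refine lintegral_mono fun y => ?_
      by_cases hy : t ≤ 2 * g y
      · rw [Set.indicator_of_mem (s := {y | t ≤ 2 * g y}) hy]
        exact le_self_add
      · refine le_add_left ?_
        rw [ENNReal.le_div_iff_mul_le (by simp) (by simp), mul_comm]
        exact (not_le.1 hy).le
    have h2 : t / 2 * volume I + t / 2 * volume I ≤
        (∫⁻ y in I, {y | t ≤ 2 * g y}.indicator g y) + t / 2 * volume I := by
      rw [← add_mul, ENNReal.add_halves]
      exact hI.2.trans hle
    exact (ENNReal.add_le_add_iff_right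
      (ENNReal.mul_ne_top (ENNReal.div_ne_top ht two_ne_zero) hIfin)).1 h2
  calc t * volume (superlevel J g t)
      = 2 * (t / 2 * volume (superlevel J g t)) := by
        rw [← mul_assoc, ENNReal.mul_div_cancel (by simp) (by simp)]
    _ ≤ 2 * (6 * ∫⁻ y in J, {y | t ≤ 2 * g y}.indicator g y) := by
        exact mul_le_mul_right
          ((mul_le_mul_right (measure_mono hsub) _).trans (mul_volume_superlevel_le hJ)) _
    _ = _ := by rw [← mul_assoc]; norm_num

/-- A geometric sum of ratio `r > 1` is comparable to its last term, here the largest `k` with `2 ^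
k ≤ z`. Partial sums also cover `z = ∞`. -/
theorem sum_geometric_le {s : ℝ} (hs : 1 < s) :
    ∃ C : ℝ≥0, ∀ z : ℝ≥0∞,
      ∑' k : ℕ, (if (2 : ℝ≥0∞) ^ k ≤ z then ((2 : ℝ≥0∞) ^ (s - 1)) ^ k else 0) ≤
        C * z ^ (s - 1) := by
  have hr : (1 : ℝ) < 2 ^ (s - 1) := Real.one_lt_rpow one_lt_two (by linarith)
  set r : ℝ := 2 ^ (s - 1) with hrdef
  have hrE : (2 : ℝ≥0∞) ^ (s - 1) = ENNReal.ofReal r := by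
    rw [hrdef, ← ENNReal.ofReal_rpow_of_pos two_pos]; norm_num
  -- The constant `r / (r - 1)` is the fixed point that closes the induction in `hfull`.
  have hC : ENNReal.ofReal (r / (r - 1)) + ENNReal.ofReal r =
      ENNReal.ofReal (r / (r - 1)) * ENNReal.ofReal r := by
    have : 0 ≤ r / (r - 1) := div_nonneg (by linarith) (by linarith)
    rw [← ENNReal.ofReal_add this (by linarith), ← ENNReal.ofReal_mul this]
    congr 1
    have : r - 1 ≠ 0 := by linarith
    field_simp
    ring
  have hfull : ∀ n : ℕ, ∑ k ∈ Finset.range (n + 1), ENNReal.ofReal r ^ k ≤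
      ENNReal.ofReal (r / (r - 1)) * ENNReal.ofReal r ^ n := by
    intro n
    induction n with
    | zero =>
      simp only [zero_add, Finset.sum_range_one, pow_zero, mul_one]
      rw [ENNReal.one_le_ofReal, one_le_div (by linarith)]
      linarith
    | succ n ih =>
      rw [Finset.sum_range_succ]
      calc _ ≤ ENNReal.ofReal (r / (r - 1)) * ENNReal.ofReal r ^ n + ENNReal.ofReal r ^ (n + 1) := by
            gcongr
        _ = (ENNReal.ofReal (r / (r - 1)) + ENNReal.ofReal r) * ENNReal.ofReal r ^ n := by ring
        _ = _ := by rw [hC]; ring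
  refine ⟨(r / (r - 1)).toNNReal, fun z => ?_⟩
  rw [hrE]
  refine ENNReal.tsum_le_of_sum_range_le fun n => ?_
  induction n with
  | zero => simp
  | succ n ih =>
    by_cases hn : (2 : ℝ≥0∞) ^ n ≤ z
    · calc _ ≤ ∑ k ∈ Finset.range (n + 1), ENNReal.ofReal r ^ k := by
            refine Finset.sum_le_sum fun k _ => ?_
            split_ifs
            · exact le_rfl
            · exact zero_le
        _ ≤ _ := hfull n
        _ ≤ _ := by
          have : ENNReal.ofReal r ^ n ≤ z ^ (s - 1) := by
            rw [← hrE, ← ENNReal.rpow_natCast, ← ENNReal.rpow_mul, mul_comm, ENNReal.rpow_mul,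
              ENNReal.rpow_natCast]
            exact ENNReal.rpow_le_rpow hn (by linarith)
          exact mul_le_mul_right this _
    · rw [Finset.sum_range_succ, if_neg hn, add_zero]
      exact ih

/-- The strong type inequality for the maximal operator, in dyadic form. -/
theorem tsum_volume_superlevel_le {s : ℝ} (hs : 1 < s) :
    ∃ C : ℝ≥0, ∀ (J : Set ℝ) (h : ℝ → ℝ≥0∞), volume J ≠ ∞ → AEMeasurable h (volume.restrict J) →
      ∑' k : ℕ, ((2 : ℝ≥0∞) ^ k) ^ s * volume (superlevel J h (2 ^ k)) ≤
        C * ∫⁻ y in J, h y ^ s := by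
  obtain ⟨C, hC⟩ := sum_geometric_le hs
  refine ⟨12 * C * 2 ^ (s - 1), fun J h hJ hh => ?_⟩
  have hpow : ∀ k : ℕ, ((2 : ℝ≥0∞) ^ k) ^ s = ((2 : ℝ≥0∞) ^ (s - 1)) ^ k * 2 ^ k := by
    intro k
    have h2 : (2 : ℝ≥0∞) ^ s = 2 ^ (s - 1) * 2 := by
      conv_lhs => rw [show s = (s - 1) + 1 by ring]
      rw [ENNReal.rpow_add _ _ (by simp) (by simp), ENNReal.rpow_one]
    rw [← mul_pow, ← h2, ← ENNReal.rpow_natCast, ← ENNReal.rpow_natCast, ← ENNReal.rpow_mul,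
      ← ENNReal.rpow_mul, mul_comm]
  have hmeas : ∀ k : ℕ, AEMeasurable ({y | (2 : ℝ≥0∞) ^ k ≤ 2 * h y}.indicator h)
      (volume.restrict J) := fun k =>
    hh.indicator₀ (nullMeasurableSet_le aemeasurable_const (hh.const_mul 2))
  calc _ ≤ ∑' k : ℕ, ((2 : ℝ≥0∞) ^ (s - 1)) ^ k *
        (12 * ∫⁻ y in J, {y | (2 : ℝ≥0∞) ^ k ≤ 2 * h y}.indicator h y) := by
        refine ENNReal.tsum_le_tsum fun k => ?_
        rw [hpow, mul_assoc]
        exact mul_le_mul_right (half_mul_volume_superlevel_le hJ (by simp)) _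
    _ = 12 * ∫⁻ y in J, ∑' k : ℕ, ((2 : ℝ≥0∞) ^ (s - 1)) ^ k *
        {y | (2 : ℝ≥0∞) ^ k ≤ 2 * h y}.indicator h y := by
        rw [lintegral_tsum fun k => (hmeas k).const_mul _, ← ENNReal.tsum_mul_left]
        refine tsum_congr fun k => ?_
        rw [lintegral_const_mul'' _ (hmeas k)]
        ring
    _ ≤ 12 * ∫⁻ y in J, (C * 2 ^ (s - 1) : ℝ≥0) * h y ^ s := by
        gcongr with y
        calc _ = (∑' k : ℕ, (if (2 : ℝ≥0∞) ^ k ≤ 2 * h y then ((2 : ℝ≥0∞) ^ (s - 1)) ^ k else 0)) *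
              h y := by
              rw [← ENNReal.tsum_mul_right]
              refine tsum_congr fun k => ?_
              by_cases hk : (2 : ℝ≥0∞) ^ k ≤ 2 * h y
              · rw [if_pos hk, Set.indicator_of_mem (s := {y | (2 : ℝ≥0∞) ^ k ≤ 2 * h y}) hk]
              · rw [if_neg hk, Set.indicator_of_notMem (s := {y | (2 : ℝ≥0∞) ^ k ≤ 2 * h y}) hk]
                simp
          _ ≤ C * (2 * h y) ^ (s - 1) * h y := mul_le_mul_left (hC _) _
          _ = _ := by
              have : h y ^ s = h y ^ (s - 1) * h y := by
                conv_lhs => rw [show s = (s - 1) + 1 by ring]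
                rw [ENNReal.rpow_add_of_nonneg _ _ (by linarith) zero_le_one, ENNReal.rpow_one]
              rw [ENNReal.mul_rpow_of_nonneg _ _ (by linarith), this]
              push_cast
              rw [ENNReal.coe_rpow_of_nonneg _ (by linarith)]
              push_cast
              ring
    _ = _ := by
        rw [lintegral_const_mul'' _ (hh.pow_const s)]
        push_cast
        ring

end Maximal


/-! ### Log-Hölder exponents -/

section Exponent

variable {J : Set ℝ} {p : ℝ → ℝ}

theorem exists_real_bounds (hp1 : 1 < expMinus p J) (hp2 : expPlus p J < ⊤) :
    ∃ s P : ℝ, 1 < s ∧ 0 ≤ P ∧ (∀ x ∈ J, s ≤ p x) ∧ ∀ x ∈ J, p x ≤ P := by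
  obtain ⟨s, hs1, hs2⟩ := EReal.lt_iff_exists_real_btwn.1 hp1
  obtain ⟨P, hP1, -⟩ := EReal.lt_iff_exists_real_btwn.1 hp2
  -- If `J` is empty, `P` could be negative.
  refine ⟨s, max P 0, by exact_mod_cast hs1, le_max_right _ _, fun x hx => ?_, fun x hx => ?_⟩
  · exact_mod_cast hs2.le.trans (iInf₂_le x hx)
  · exact (EReal.coe_le_coe_iff.1
      ((le_iSup₂ (f := fun x (_ : x ∈ J) => (p x : EReal)) x hx).trans hP1.le)).trans
      (le_max_left _ _)

theorem LogHolderOn.continuousOn (hp : LogHolderOn p J) : ContinuousOn p J := by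
  obtain ⟨c, -, hc⟩ := hp
  intro x hx
  -- The default value `c / (-log 0) = 0` agrees with the limit at `0`.
  have h0 : ContinuousAt (fun z : ℝ => c / (-Real.log z)) 0 := by
    rw [continuousAt_iff_punctured_nhds]
    simp only [Real.log_zero, neg_zero, div_zero]
    exact (Filter.tendsto_neg_atBot_atTop.comp Real.tendsto_log_nhdsNE_zero).const_div_atTop c
  have h1 : Filter.Tendsto (fun y : ℝ => |x - y|) (nhdsWithin x J) (nhds 0) := by
    have : ContinuousAt (fun y : ℝ => |x - y|) x := by fun_prop
    simpa using this.tendsto.mono_left nhdsWithin_le_nhds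
  have h2 : Filter.Tendsto (fun y : ℝ => c / (-Real.log |x - y|)) (nhdsWithin x J) (nhds 0) := by
    have h := h0.tendsto.comp h1
    rwa [Real.log_zero, neg_zero, div_zero] at h
  refine tendsto_iff_norm_sub_tendsto_zero.2 (squeeze_zero' (.of_forall fun _ => norm_nonneg _) ?_ h2)
  filter_upwards [self_mem_nhdsWithin, h1.eventually (Iic_mem_nhds (by norm_num : (0 : ℝ) < 1 / 2))]
    with y hy hy2
  rw [Real.norm_eq_abs, abs_sub_comm]
  exact hc x hx y hy hy2

theorem LogHolderOn.aemeasurable (hp : LogHolderOn p J) (hJ : J.OrdConnected) :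
    AEMeasurable p (volume.restrict J) :=
  hp.continuousOn.aemeasurable hJ.measurableSet

/-- On a bounded interval the log-Hölder condition bounds the oscillation of `p` on every
subinterval by a multiple of the inverse logarithm of its length. -/
theorem LogHolderOn.abs_sub_mul_abs_log_le (hp : LogHolderOn p J) (hJ : volume J ≠ ∞) {P : ℝ}
    (hP : 0 ≤ P) (hp0 : ∀ x ∈ J, 0 ≤ p x) (hpP : ∀ x ∈ J, p x ≤ P) :
    ∃ D : ℝ, 0 ≤ D ∧ ∀ I, IsSubinterval I J → ∀ x ∈ I, ∀ y ∈ I,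
      |p x - p y| * |Real.log (volume I).toReal| ≤ D := by
  obtain ⟨c, hc0, hc⟩ := hp
  have hJ0 : 0 ≤ (volume J).toReal := ENNReal.toReal_nonneg
  have hPJ : 0 ≤ P * (1 + (volume J).toReal) := by positivity
  refine ⟨c + P * (1 + (volume J).toReal), by positivity, fun I hI x hx y hy => ?_⟩
  have hIfin : volume I ≠ ∞ := ne_top_of_le_ne_top hJ hI.volume_le
  have hlpos : 0 < (volume I).toReal := ENNReal.toReal_pos hI.volume_pos.ne' hIfin
  have hlJ : (volume I).toReal ≤ (volume J).toReal := ENNReal.toReal_mono hJ hI.volume_le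
  have hxy := (ENNReal.ofReal_le_iff_le_toReal hIfin).1 (ofReal_abs_sub_le_volume hI.1 hx hy)
  set l := (volume I).toReal
  rcases le_or_gt (1 / 2) l with hl | hl
  · have h1 : |p x - p y| ≤ P := by
      have := hp0 x (hI.2.2 hx); have := hp0 y (hI.2.2 hy)
      have := hpP x (hI.2.2 hx); have := hpP y (hI.2.2 hy)
      rw [abs_le]; constructor <;> linarith
    -- For `1/2 ≤ l ≤ |J|`: `-1 ≤ 1 - 1/l ≤ log l ≤ l - 1`.
    have h2 : |Real.log l| ≤ 1 + (volume J).toReal := by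
      have := Real.log_le_sub_one_of_pos hlpos
      have := Real.one_sub_inv_le_log_of_pos hlpos
      have : l⁻¹ ≤ 2 := by
        rw [inv_le_comm₀ hlpos two_pos]; linarith
      rw [abs_le]; constructor <;> linarith
    calc _ ≤ P * (1 + (volume J).toReal) := mul_le_mul h1 h2 (abs_nonneg _) hP
      _ ≤ _ := by linarith
  · rcases eq_or_ne x y with rfl | hne
    · simp only [sub_self, abs_zero, zero_mul]
      positivity
    · have hpos : 0 < |x - y| := abs_pos.2 (sub_ne_zero.2 hne)
      have hlog : Real.log l < 0 := Real.log_neg hlpos (by linarith)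
      have hle : -Real.log l ≤ -Real.log |x - y| := neg_le_neg (Real.log_le_log hpos hxy)
      have h1 := hc x (hI.2.2 hx) y (hI.2.2 hy) (hxy.trans hl.le)
      rw [abs_of_neg hlog]
      have : |p x - p y| ≤ c / (-Real.log l) :=
        h1.trans (div_le_div_of_nonneg_left hc0.le (by linarith) hle)
      rw [le_div_iff₀ (by linarith)] at this
      linarith

end Exponent

theorem rpow_le_ofReal_exp {V : ℝ≥0∞} (h0 : V ≠ 0) (ht : V ≠ ∞) {e D : ℝ}
    (h : |e| * |Real.log V.toReal| ≤ D) : V ^ e ≤ ENNReal.ofReal (Real.exp D) := by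
  have hpos := ENNReal.toReal_pos h0 ht
  conv_lhs => rw [← ENNReal.ofReal_toReal ht]
  rw [ENNReal.ofReal_rpow_of_pos hpos, Real.rpow_def_of_pos hpos]
  refine ENNReal.ofReal_le_ofReal (Real.exp_le_exp.2 (le_trans ?_ h))
  rw [← abs_mul, mul_comm]
  exact le_abs_self _

theorem rpow_le_one_add_rpow (a : ℝ≥0∞) {e d : ℝ} (he : 0 ≤ e) (hed : e ≤ d) :
    a ^ e ≤ 1 + a ^ d := by
  rcases le_total a 1 with ha | ha
  · exact (ENNReal.rpow_le_one ha he).trans le_self_add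
  · exact (ENNReal.rpow_le_rpow_of_exponent_le ha hed).trans le_add_self

/-- The average of `g` over `I`. -/
noncomputable def avg (I : Set ℝ) (g : ℝ → ℝ≥0∞) : ℝ≥0∞ := (volume I)⁻¹ * ∫⁻ y in I, g y

theorem avg_mono {I : Set ℝ} (hI : MeasurableSet I) {g h : ℝ → ℝ≥0∞} (hgh : ∀ x ∈ I, g x ≤ h x) :
    avg I g ≤ avg I h :=
  mul_le_mul_right (setLIntegral_mono' hI hgh) _

/-- Jensen's inequality for averages. -/
theorem avg_rpow_le {I : Set ℝ} (h0 : volume I ≠ 0) (ht : volume I ≠ ∞) {g : ℝ → ℝ≥0∞}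
    (hg : AEMeasurable g (volume.restrict I)) {q : ℝ} (hq : 1 ≤ q) :
    avg I g ^ q ≤ avg I fun y => g y ^ q := by
  have hq0 : 0 < q := by linarith
  have h := eLpNorm'_le_eLpNorm'_mul_rpow_measure_univ one_pos hq hg.aestronglyMeasurable
  simp only [eLpNorm', enorm_eq_self, ENNReal.rpow_one, div_one, Measure.restrict_apply_univ] at h
  unfold avg
  calc ((volume I)⁻¹ * ∫⁻ y in I, g y) ^ q
      ≤ ((volume I)⁻¹ * ((∫⁻ y in I, g y ^ q) ^ (1 / q) * volume I ^ (1 - 1 / q))) ^ q := by gcongr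
    _ = ((volume I)⁻¹ ^ q * volume I ^ (q - 1)) * ∫⁻ y in I, g y ^ q := by
        rw [ENNReal.mul_rpow_of_nonneg _ _ hq0.le, ENNReal.mul_rpow_of_nonneg _ _ hq0.le,
          ← ENNReal.rpow_mul, ← ENNReal.rpow_mul, one_div_mul_cancel hq0.ne', ENNReal.rpow_one,
          show (1 - 1 / q) * q = q - 1 by field_simp]
        ring
    _ = _ := by
        rw [ENNReal.inv_rpow, ← ENNReal.rpow_neg, ← ENNReal.rpow_add _ _ h0 ht,
          show -q + (q - 1) = -1 by ring, ENNReal.rpow_neg_one]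

/-! ### The modular inequality -/

section Core

variable {J : Set ℝ} {p : ℝ → ℝ} {F : ℝ → ℝ≥0∞} {s P D : ℝ}

theorem lintegral_le_of_modular_le_one (hJ : J.OrdConnected) (hs : 1 ≤ s)
    (hps : ∀ x ∈ J, s ≤ p x) (hFp : modular p J F ≤ 1) : ∫⁻ y in J, F y ≤ volume J + 1 := by
  calc ∫⁻ y in J, F y ≤ ∫⁻ y in J, (1 + F y ^ p y) := by
        refine setLIntegral_mono' hJ.measurableSet fun y hy => ?_
        simpa using rpow_le_one_add_rpow (F y) zero_le_one (hs.trans (hps y hy))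
    _ = volume J + modular p J F := by
        rw [lintegral_add_left measurable_const]
        simp [modular]
    _ ≤ _ := by gcongr

/-- The variable exponent Jensen inequality. -/
theorem avg_rpow_le_mul_avg_rpow (hJ : J.OrdConnected) (hJfin : volume J ≠ ∞) (hs : 1 < s)
    (hps : ∀ x ∈ J, s ≤ p x) (hpP : ∀ x ∈ J, p x ≤ P)
    (hD : ∀ I, IsSubinterval I J → ∀ x ∈ I, ∀ y ∈ I,
      |p x - p y| * |Real.log (volume I).toReal| ≤ D)
    (hF : AEMeasurable F (volume.restrict J)) (hFp : modular p J F ≤ 1)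
    {I : Set ℝ} (hI : IsSubinterval I J) {x : ℝ} (hx : x ∈ I) :
    avg I F ^ p x ≤ ENNReal.ofReal (Real.exp D) * (volume J + 1) ^ P *
      avg I (fun y => 1 + F y ^ (p y / s)) ^ s := by
  have h0 := hI.volume_pos.ne'
  have ht : volume I ≠ ∞ := ne_top_of_le_ne_top hJfin hI.volume_le
  have hs0 : 0 < s := by linarith
  have hne : (p '' I).Nonempty := ⟨_, Set.mem_image_of_mem _ hx⟩
  have hbdd : BddBelow (p '' I) := by
    refine ⟨s, ?_⟩
    rintro _ ⟨y, hy, rfl⟩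
    exact hps y (hI.2.2 hy)
  -- Split `p x = (p x - m) + m`: constant exponent Jensen handles `m`, and log-Hölder handles the
  -- small excess.
  set m := sInf (p '' I) with hm
  have hmle : ∀ y ∈ I, m ≤ p y := fun y hy => csInf_le hbdd (Set.mem_image_of_mem _ hy)
  have hsm : s ≤ m := by
    refine le_csInf hne ?_
    rintro _ ⟨y, hy, rfl⟩
    exact hps y (hI.2.2 hy)
  have hxm : 0 ≤ p x - m := sub_nonneg.2 (hmle x hx)
  have hosc : |m - p x| * |Real.log (volume I).toReal| ≤ D := by
    rw [abs_sub_comm, abs_of_nonneg hxm]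
    rcases (abs_nonneg (Real.log (volume I).toReal)).eq_or_lt with hl | hl
    · rw [← hl, mul_zero]
      simpa using hD I hI x hx x hx
    · rw [← le_div_iff₀ hl, sub_le_comm]
      refine le_csInf hne ?_
      rintro _ ⟨y, hy, rfl⟩
      rw [sub_le_comm, le_div_iff₀ hl]
      exact (mul_le_mul_of_nonneg_right (le_abs_self _) hl.le).trans (hD I hI x hx y hy)
  have hFI : ∫⁻ y in I, F y ≤ volume J + 1 :=
    (lintegral_mono_set hI.2.2).trans (lintegral_le_of_modular_le_one hJ hs.le hps hFp)
  have hjen : avg I F ^ m ≤ avg I (fun y => 1 + F y ^ (p y / s)) ^ s := by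
    have hms : 1 ≤ m / s := by rwa [le_div_iff₀ hs0, one_mul]
    calc avg I F ^ m = (avg I F ^ (m / s)) ^ s := by
          rw [← ENNReal.rpow_mul, div_mul_cancel₀ _ hs0.ne']
      _ ≤ (avg I fun y => F y ^ (m / s)) ^ s := by
          gcongr
          exact avg_rpow_le h0 ht (hF.mono_measure (Measure.restrict_mono hI.2.2 le_rfl)) hms
      _ ≤ _ := by
          gcongr
          refine avg_mono hI.measurableSet fun y hy => ?_
          -- The summand `1` covers points with `F y < 1`, where raising the exponent lowers the
          -- power.
          exact rpow_le_one_add_rpow _ (by linarith) (by gcongr; exact hmle y hy)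
  have hrest : avg I F ^ (p x - m) ≤ ENNReal.ofReal (Real.exp D) * (volume J + 1) ^ P := by
    calc avg I F ^ (p x - m) ≤ ((volume I)⁻¹ * (volume J + 1)) ^ (p x - m) := by
          unfold avg; gcongr
      _ = volume I ^ (m - p x) * (volume J + 1) ^ (p x - m) := by
          rw [ENNReal.mul_rpow_of_nonneg _ _ hxm, ENNReal.inv_rpow, ← ENNReal.rpow_neg, neg_sub]
      _ ≤ _ := by
          gcongr
          · exact rpow_le_ofReal_exp h0 ht hosc
          · exact le_add_self
          · have := hpP x (hI.2.2 hx)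
            linarith
  calc avg I F ^ p x = avg I F ^ (p x - m) * avg I F ^ m := by
        rw [← ENNReal.rpow_add_of_nonneg _ _ hxm (by linarith), sub_add_cancel]
    _ ≤ _ := mul_le_mul' hrest hjen

/-- The fractional maximal function of a function with values in `[0, ∞]`. -/
noncomputable def eFracMaximal (J : Set ℝ) (α : ℝ) (F : ℝ → ℝ≥0∞) (x : ℝ) : ℝ≥0∞ :=
  ⨆ (I : Set ℝ) (_ : IsSubinterval I J) (_ : x ∈ I), (volume I ^ (1 - α))⁻¹ * ∫⁻ y in I, F y

theorem eFracMaximal_le_mul (α : ℝ) {l : ℝ≥0∞} (h0 : l ≠ 0) (ht : l ≠ ∞) (x : ℝ) :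
    eFracMaximal J α F x ≤ l * eFracMaximal J α (fun y => F y / l) x := by
  refine iSup_le fun I => iSup₂_le fun hI hx => ?_
  calc (volume I ^ (1 - α))⁻¹ * ∫⁻ y in I, F y
      = l * ((volume I ^ (1 - α))⁻¹ * ∫⁻ y in I, F y / l) := by
        simp only [div_eq_mul_inv]
        rw [lintegral_mul_const' _ _ (ENNReal.inv_ne_top.2 h0)]
        calc _ = (volume I ^ (1 - α))⁻¹ * (∫⁻ y in I, F y) * (l * l⁻¹) := by
              rw [ENNReal.mul_inv_cancel h0 ht, mul_one]
          _ = _ := by ring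
    _ ≤ _ := by
        gcongr
        exact le_iSup_of_le I (le_iSup₂_of_le hI hx le_rfl)

/-- Pointwise bound of the weighted maximal function by a sum over the components of the dyadic
superlevel sets. -/
theorem mul_eFracMaximal_rpow_le (hJfin : volume J ≠ ∞) (hs : 1 < s)
    (hps : ∀ x ∈ J, s ≤ p x) {α : ℝ} (hα : 0 ≤ α) {K : ℝ≥0∞} {h : ℝ → ℝ≥0∞}
    (h1 : ∀ x, 1 ≤ h x) (hfin : ∫⁻ y in J, h y ≠ ∞)
    (hK : ∀ I, IsSubinterval I J → ∀ x ∈ I, avg I F ^ p x ≤ K * avg I h ^ s)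
    (w : ℝ≥0∞) {x : ℝ} (hx : x ∈ J) :
    (w * eFracMaximal J α F x) ^ p x ≤ K * 2 ^ s * ∑' k : ℕ, ((2 : ℝ≥0∞) ^ k) ^ s *
      (superlevel J h (2 ^ k)).indicator (fun x => w ^ p x *
        volume ((superlevel J h (2 ^ k)).ordConnectedComponent x) ^ (α * p x)) x := by
  have hs0 : 0 < s := by linarith
  have hp0 : 0 < p x := hs0.trans_le (hps x hx)
  -- Moving the exponent across lets the supremum be bounded one interval at a time.
  rw [← ENNReal.le_rpow_inv_iff hp0]
  unfold eFracMaximal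
  simp only [ENNReal.mul_iSup]
  refine iSup_le fun I => iSup₂_le fun hI hxI => ?_
  rw [ENNReal.le_rpow_inv_iff hp0]
  have h0 := hI.volume_pos.ne'
  have ht : volume I ≠ ∞ := ne_top_of_le_ne_top hJfin hI.volume_le
  have hhI : avg I h ≠ ∞ := ENNReal.mul_ne_top (ENNReal.inv_ne_top.2 h0)
    (ne_top_of_le_ne_top hfin (lintegral_mono_set hI.2.2))
  have hhI1 : 1 ≤ avg I h := by
    calc (1 : ℝ≥0∞) = avg I fun _ => 1 := by simp [avg, ENNReal.inv_mul_cancel h0 ht]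
      _ ≤ _ := avg_mono hI.measurableSet fun x _ => h1 x
  -- Since `h ≥ 1`, the levels `k ≥ 0` suffice.
  obtain ⟨k, hk1, hk2⟩ : ∃ k : ℕ, (2 : ℝ≥0∞) ^ k ≤ avg I h ∧ avg I h < 2 ^ (k + 1) := by
    lift avg I h to ℝ≥0 using hhI with a
    obtain ⟨k, hk⟩ := exists_nat_pow_near (y := (2 : ℝ≥0)) (by exact_mod_cast hhI1) one_lt_two
    exact ⟨k, by exact_mod_cast hk.1, by exact_mod_cast hk.2⟩
  have hsubO : I ⊆ superlevel J h (2 ^ k) := by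
    refine subset_superlevel hI ?_
    calc _ ≤ avg I h * volume I := by gcongr
      _ = _ := by
        rw [avg, mul_comm, ← mul_assoc, ENNReal.mul_inv_cancel h0 ht, one_mul]
  have hIR : I ⊆ (superlevel J h (2 ^ k)).ordConnectedComponent x :=
    have := hI.1
    Set.subset_ordConnectedComponent hxI hsubO
  refine le_trans ?_ (mul_le_mul_right (ENNReal.le_tsum k) _)
  rw [Set.indicator_of_mem (hsubO hxI)]
  have hscale : (volume I ^ (1 - α))⁻¹ * ∫⁻ y in I, F y = volume I ^ α * avg I F := by
    rw [avg, ← mul_assoc, ← ENNReal.rpow_neg, ← ENNReal.rpow_neg_one (volume I),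
      ← ENNReal.rpow_add _ _ h0 ht]
    congr 2; ring
  calc (w * ((volume I ^ (1 - α))⁻¹ * ∫⁻ y in I, F y)) ^ p x
      = w ^ p x * volume I ^ (α * p x) * avg I F ^ p x := by
        rw [hscale, ENNReal.mul_rpow_of_nonneg _ _ hp0.le, ENNReal.mul_rpow_of_nonneg _ _ hp0.le,
          ENNReal.rpow_mul, mul_assoc]
    _ ≤ w ^ p x * volume ((superlevel J h (2 ^ k)).ordConnectedComponent x) ^ (α * p x) *
        (K * (2 ^ s * ((2 : ℝ≥0∞) ^ k) ^ s)) := by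
        gcongr
        refine (hK I hI x hxI).trans (mul_le_mul_right ?_ _)
        rw [← ENNReal.mul_rpow_of_nonneg _ _ hs0.le, ← pow_succ']
        gcongr
    _ = _ := by ring

/-- The weighted modular inequality for the fractional maximal function. -/
theorem exists_modular_eFracMaximal_le (hJ : J.OrdConnected) (hJb : Bornology.IsBounded J)
    (hp1 : 1 < expMinus p J) (hp2 : expPlus p J < ⊤) (hp : LogHolderOn p J)
    {α : ℝ} (hα : 0 ≤ α) {v : ℝ → ℝ≥0} (hv : AEMeasurable v (volume.restrict J))
    (hB : (⨆ (I : Set ℝ) (_ : IsSubinterval I J),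
      (volume I)⁻¹ * ∫⁻ x in I, (v x : ℝ≥0∞) ^ p x * volume I ^ (α * p x)) < ∞) :
    ∃ A : ℝ≥0, ∀ F : ℝ → ℝ≥0∞, AEMeasurable F (volume.restrict J) → modular p J F ≤ 1 →
      modular p J (fun x => v x * eFracMaximal J α F x) ≤ A := by
  have hJfin : volume J ≠ ∞ := hJb.measure_lt_top.ne
  obtain ⟨s, P, hs, hP, hps, hpP⟩ := exists_real_bounds hp1 hp2
  have hs0 : 0 < s := by linarith
  obtain ⟨D, -, hD⟩ := hp.abs_sub_mul_abs_log_le hJfin hP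
    (fun x hx => hs0.le.trans (hps x hx)) hpP
  obtain ⟨C, hC⟩ := tsum_volume_superlevel_le hs
  set B := ⨆ (I : Set ℝ) (_ : IsSubinterval I J),
      (volume I)⁻¹ * ∫⁻ x in I, (v x : ℝ≥0∞) ^ p x * volume I ^ (α * p x) with hBdef
  have hpm := hp.aemeasurable hJ
  set K : ℝ≥0∞ := ENNReal.ofReal (Real.exp D) * (volume J + 1) ^ P with hKdef
  set A : ℝ≥0∞ := K * 2 ^ s * (B * (C * (2 ^ (s - 1) * (volume J + 1)))) with hAdef
  have hJ1 : volume J + 1 ≠ ∞ := by simp [hJfin]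
  have hA : A ≠ ∞ := by
    refine ENNReal.mul_ne_top (ENNReal.mul_ne_top (ENNReal.mul_ne_top ENNReal.ofReal_ne_top ?_) ?_)
      (ENNReal.mul_ne_top hB.ne (ENNReal.mul_ne_top ENNReal.coe_ne_top (ENNReal.mul_ne_top ?_ hJ1)))
    · exact ENNReal.rpow_ne_top_of_nonneg hP hJ1
    · exact ENNReal.rpow_ne_top_of_nonneg hs0.le (by simp)
    · exact ENNReal.rpow_ne_top_of_nonneg (by linarith) (by simp)
  refine ⟨A.toNNReal, fun F hF hFp => ?_⟩
  rw [ENNReal.coe_toNNReal hA]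
  set h : ℝ → ℝ≥0∞ := fun y => 1 + F y ^ (p y / s) with hhdef
  have hhm : AEMeasurable h (volume.restrict J) := (hF.pow (hpm.div_const s)).const_add 1
  have hhs : ∫⁻ y in J, h y ^ s ≤ 2 ^ (s - 1) * (volume J + 1) := by
    calc ∫⁻ y in J, h y ^ s ≤ ∫⁻ y in J, 2 ^ (s - 1) * (1 + F y ^ p y) := by
          refine lintegral_mono fun y => ?_
          refine (ENNReal.rpow_add_le_mul_rpow_add_rpow _ _ hs.le).trans (le_of_eq ?_)
          rw [ENNReal.one_rpow, ← ENNReal.rpow_mul, div_mul_cancel₀ _ hs0.ne']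
      _ = 2 ^ (s - 1) * (volume J + modular p J F) := by
          rw [lintegral_const_mul' _ _ (ENNReal.rpow_ne_top_of_nonneg (by linarith) (by simp)),
            lintegral_add_left measurable_const]
          simp [modular]
      _ ≤ _ := by gcongr
  have hh1 : ∀ y, 1 ≤ h y := fun y => le_self_add
  have hhfin : ∫⁻ y in J, h y ≠ ∞ := by
    refine ne_top_of_le_ne_top (ENNReal.mul_ne_top ?_ hJ1) (le_trans (lintegral_mono fun y => ?_) hhs)
    · exact ENNReal.rpow_ne_top_of_nonneg (by linarith) (by simp)
    · simpa using ENNReal.rpow_le_rpow_of_exponent_le (hh1 y) hs.le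
  have hO : ∀ k : ℕ, IsIntervalUnion (superlevel J h (2 ^ k)) := fun k => isIntervalUnion_superlevel
  have hmeas : ∀ k : ℕ, AEMeasurable ((superlevel J h (2 ^ k)).indicator (fun x => (v x : ℝ≥0∞) ^ p x *
        volume ((superlevel J h (2 ^ k)).ordConnectedComponent x) ^ (α * p x)))
        (volume.restrict J) := fun k =>
    ((hv.coe_nnreal_ennreal.pow hpm).mul
      ((hO k).measurable_volume_component.aemeasurable.pow (hpm.const_mul α))).indicator
      (hO k).measurableSet
  have hcomp : ∀ k : ℕ, ∫⁻ x in J, (superlevel J h (2 ^ k)).indicator (fun x => (v x : ℝ≥0∞) ^ p x *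
        volume ((superlevel J h (2 ^ k)).ordConnectedComponent x) ^ (α * p x)) x ≤
        B * volume (superlevel J h (2 ^ k)) := by
    intro k
    rw [setLIntegral_indicator (hO k).measurableSet, Set.inter_eq_left.2 superlevel_subset]
    refine (hO k).lintegral_le (fun x V => (v x : ℝ≥0∞) ^ p x * V ^ (α * p x)) B fun x hx => ?_
    set R := (superlevel J h (2 ^ k)).ordConnectedComponent x
    have hR : IsSubinterval R J := ⟨inferInstance, (hO k).nontrivial_component hx,
      Set.ordConnectedComponent_subset.trans superlevel_subset⟩
    have hRfin : volume R ≠ ∞ := ne_top_of_le_ne_top hJfin hR.volume_le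
    rw [mul_comm, ← ENNReal.inv_mul_le_iff hR.volume_pos.ne' hRfin]
    exact le_iSup₂ (f := fun (I : Set ℝ) (_ : IsSubinterval I J) =>
      (volume I)⁻¹ * ∫⁻ x in I, (v x : ℝ≥0∞) ^ p x * volume I ^ (α * p x)) R hR
  -- Only the majorant needs to be measurable, not the maximal function.
  calc modular p J (fun x => v x * eFracMaximal J α F x)
      ≤ ∫⁻ x in J, K * 2 ^ s * ∑' k : ℕ, ((2 : ℝ≥0∞) ^ k) ^ s *
        (superlevel J h (2 ^ k)).indicator (fun x => (v x : ℝ≥0∞) ^ p x *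
        volume ((superlevel J h (2 ^ k)).ordConnectedComponent x) ^ (α * p x)) x := by
        refine setLIntegral_mono' hJ.measurableSet fun x hx => ?_
        exact mul_eFracMaximal_rpow_le hJfin hs hps hα hh1 hhfin
          (fun I hI x hx => avg_rpow_le_mul_avg_rpow hJ hJfin hs hps hpP hD hF hFp hI hx) _ hx
    _ = K * 2 ^ s * ∑' k : ℕ, ((2 : ℝ≥0∞) ^ k) ^ s *
        ∫⁻ x in J, (superlevel J h (2 ^ k)).indicator (fun x => (v x : ℝ≥0∞) ^ p x *
        volume ((superlevel J h (2 ^ k)).ordConnectedComponent x) ^ (α * p x)) x := by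
        rw [lintegral_const_mul'' _ (AEMeasurable.tsum fun k => (hmeas k).const_mul _),
          lintegral_tsum fun k => (hmeas k).const_mul _]
        congr 1
        exact tsum_congr fun k => lintegral_const_mul'' _ (hmeas k)
    _ ≤ K * 2 ^ s * ∑' k : ℕ, ((2 : ℝ≥0∞) ^ k) ^ s * (B * volume (superlevel J h (2 ^ k))) := by
        gcongr with k
        exact hcomp k
    _ = K * 2 ^ s * (B * ∑' k : ℕ, ((2 : ℝ≥0∞) ^ k) ^ s * volume (superlevel J h (2 ^ k))) := by
        rw [← ENNReal.tsum_mul_left (a := B)]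
        congr 1
        exact tsum_congr fun k => by ring
    _ ≤ A := by
        rw [hAdef]
        gcongr
        exact (hC J h hJfin hhm).trans (mul_le_mul_right hhs _)

end Core


/-! ### From modular to norm -/

section Norm

variable {J : Set ℝ} {p : ℝ → ℝ} {g : ℝ → ℝ≥0∞}

theorem luxNorm_le {l : ℝ≥0} (hl : 0 < l) (h : modular p J (fun x => g x / (l : ℝ≥0∞)) ≤ 1) :
    luxNorm p J g ≤ l :=
  iInf_le_of_le l (iInf₂_le_of_le hl h le_rfl)

theorem modular_div_le_one_of_luxNorm_lt (hJ : J.OrdConnected) (hp : ∀ x ∈ J, 0 ≤ p x) {L : ℝ≥0∞}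
    (h : luxNorm p J g < L) : modular p J (fun x => g x / L) ≤ 1 := by
  simp only [luxNorm, iInf_lt_iff] at h
  obtain ⟨l, hl, hm, hlL⟩ := h
  refine le_trans (setLIntegral_mono' hJ.measurableSet fun x hx => ?_) hm
  exact ENNReal.rpow_le_rpow (ENNReal.div_le_div_left hlL.le _) (hp x hx)

/-- With `A ≥ 1` and `p ≥ 1`, `A ^ p x ≥ A`. -/
theorem modular_div_le_one (hJ : J.OrdConnected) (hp : ∀ x ∈ J, 1 ≤ p x) {A : ℝ≥0} (hA : 1 ≤ A)
    (h : modular p J g ≤ A) : modular p J (fun x => g x / A) ≤ 1 := by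
  have hA0 : (A : ℝ≥0∞) ≠ 0 := by exact_mod_cast (zero_lt_one.trans_le hA).ne'
  calc modular p J (fun x => g x / A) ≤ ∫⁻ x in J, g x ^ p x / A := by
        refine setLIntegral_mono' hJ.measurableSet fun x hx => ?_
        rw [ENNReal.div_rpow_of_nonneg _ _ (zero_le_one.trans (hp x hx))]
        refine ENNReal.div_le_div_left ?_ _
        simpa using ENNReal.rpow_le_rpow_of_exponent_le (x := A) (by exact_mod_cast hA) (hp x hx)
    _ = modular p J g / A := by
        simp only [div_eq_mul_inv]
        rw [lintegral_mul_const' _ _ (ENNReal.inv_ne_top.2 hA0)]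
        rfl
    _ ≤ 1 := ENNReal.div_le_of_le_mul (by simpa using h)

end Norm

/-! ### Sufficiency of the testing condition -/

theorem trace_inequality_of_iSup_lt_top {J : Set ℝ} (hJ : J.OrdConnected)
    (hJb : Bornology.IsBounded J) {p : ℝ → ℝ} (hp1 : 1 < expMinus p J) (hp2 : expPlus p J < ⊤)
    (hp : LogHolderOn p J) {α : ℝ} (hα : 0 ≤ α) {v : ℝ → ℝ≥0}
    (hv : AEMeasurable v (volume.restrict J))
    (hB : (⨆ (I : Set ℝ) (_ : IsSubinterval I J),
      (volume I)⁻¹ * ∫⁻ x in I, (v x : ℝ≥0∞) ^ p x * volume I ^ (α * p x)) < ∞) :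
    ∃ c : ℝ≥0, ∀ f : ℝ → ℝ, MemVarLp p J f →
      luxNorm p J (fun x => (v x : ℝ≥0∞) * fracMaximal J α f x) ≤
        (c : ℝ≥0∞) * luxNorm p J (fun x => ‖f x‖ₑ) := by
  obtain ⟨A, hA⟩ := exists_modular_eFracMaximal_le hJ hJb hp1 hp2 hp hα hv hB
  obtain ⟨s, P, hs, -, hps, -⟩ := exists_real_bounds hp1 hp2
  set c : ℝ≥0 := max A 1
  have hc1 : 1 ≤ c := le_max_right _ _
  have hc0 : 0 < c := zero_lt_one.trans_le hc1
  have hcE : (c : ℝ≥0∞) ≠ 0 := by exact_mod_cast hc0.ne'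
  refine ⟨c, fun f hf => ?_⟩
  rw [luxNorm, luxNorm]
  simp only [ENNReal.mul_iInf_of_ne hcE ENNReal.coe_ne_top]
  -- Each `l` admissible for `f` makes `c * l` admissible for the left side.
  refine le_iInf fun l => le_iInf₂ fun hl hfl => ?_
  rw [← ENNReal.coe_mul]
  refine luxNorm_le (mul_pos hc0 hl) ?_
  have hlE : (l : ℝ≥0∞) ≠ 0 := by exact_mod_cast hl.ne'
  have h1 := modular_div_le_one hJ (fun x hx => hs.le.trans (hps x hx)) hc1
    ((hA _ (hf.1.enorm.div_const _) hfl).trans (by exact_mod_cast le_max_left A 1))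
  refine le_trans (setLIntegral_mono' hJ.measurableSet fun x hx => ?_) h1
  refine ENNReal.rpow_le_rpow ?_ (by linarith [hps x hx])
  beta_reduce
  rw [ENNReal.coe_mul, div_eq_mul_inv, div_eq_mul_inv,
    ENNReal.mul_inv (.inl hcE) (.inl ENNReal.coe_ne_top)]
  calc (v x : ℝ≥0∞) * fracMaximal J α f x * ((c : ℝ≥0∞)⁻¹ * (l : ℝ≥0∞)⁻¹)
      ≤ v x * (l * eFracMaximal J α (fun y => ‖f y‖ₑ / l) x) * ((c : ℝ≥0∞)⁻¹ * (l : ℝ≥0∞)⁻¹) := by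
        gcongr
        exact eFracMaximal_le_mul α hlE ENNReal.coe_ne_top x
    _ = v x * eFracMaximal J α (fun y => ‖f y‖ₑ / l) x * (c : ℝ≥0∞)⁻¹ * (l * (l : ℝ≥0∞)⁻¹) := by
        ring
    _ = _ := by rw [ENNReal.mul_inv_cancel hlE ENNReal.coe_ne_top, mul_one]

/-! ### Necessity of the testing condition -/

theorem rpow_div_le_mul {V : ℝ≥0∞} (h0 : V ≠ 0) (ht : V ≠ ∞) {a q D : ℝ} (hq : 1 ≤ q)
    (h : |a - q| * |Real.log V.toReal| ≤ D) :
    V ^ (a / q) ≤ ENNReal.ofReal (Real.exp D) * V ∧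
      V ≤ ENNReal.ofReal (Real.exp D) * V ^ (a / q) := by
  have hq0 : 0 < q := by linarith
  have hdiv : |a / q - 1| ≤ |a - q| := by
    rw [div_sub_one hq0.ne', abs_div, abs_of_pos hq0]
    exact div_le_self (abs_nonneg _) hq
  have hle : |a / q - 1| * |Real.log V.toReal| ≤ D :=
    (mul_le_mul_of_nonneg_right hdiv (abs_nonneg _)).trans h
  constructor
  · calc V ^ (a / q) = V ^ (a / q - 1) * V := by
          conv_rhs => rw [← ENNReal.rpow_one V, ← ENNReal.rpow_mul, one_mul,
            ← ENNReal.rpow_add _ _ h0 ht, sub_add_cancel]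
      _ ≤ _ := by
          gcongr
          exact rpow_le_ofReal_exp h0 ht hle
  · calc V = V ^ (1 - a / q) * V ^ (a / q) := by
          rw [← ENNReal.rpow_add _ _ h0 ht, sub_add_cancel, ENNReal.rpow_one]
      _ ≤ _ := by
          gcongr
          refine rpow_le_ofReal_exp h0 ht ?_
          rwa [abs_sub_comm]

theorem volume_rpow_le_fracMaximal_indicator {I J : Set ℝ} (hI : IsSubinterval I J)
    (ht : volume I ≠ ∞) (α : ℝ) {x : ℝ} (hx : x ∈ I) :
    volume I ^ α ≤ fracMaximal J α (I.indicator 1) x := by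
  refine le_iSup_of_le I (le_iSup₂_of_le hI hx ?_)
  have : ∫⁻ y in I, ‖I.indicator (1 : ℝ → ℝ) y‖ₑ = volume I := by
    rw [setLIntegral_congr_fun hI.measurableSet (g := fun _ => 1)
      fun y hy => by simp [Set.indicator_of_mem hy]]
    simp
  rw [this, ← ENNReal.rpow_neg]
  nth_rw 3 [← ENNReal.rpow_one (volume I)]
  rw [← ENNReal.rpow_add _ _ hI.volume_pos.ne' ht]
  apply le_of_eq
  congr 1
  ring

theorem iSup_lt_top_of_trace_inequality {J : Set ℝ} (hJ : J.OrdConnected)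
    (hJb : Bornology.IsBounded J) {p : ℝ → ℝ} (hp1 : 1 < expMinus p J) (hp2 : expPlus p J < ⊤)
    (hp : LogHolderOn p J) {α : ℝ} {v : ℝ → ℝ≥0} {c : ℝ≥0}
    (hc : ∀ f : ℝ → ℝ, MemVarLp p J f →
      luxNorm p J (fun x => (v x : ℝ≥0∞) * fracMaximal J α f x) ≤
        (c : ℝ≥0∞) * luxNorm p J (fun x => ‖f x‖ₑ)) :
    (⨆ (I : Set ℝ) (_ : IsSubinterval I J),
      (volume I)⁻¹ * ∫⁻ x in I, (v x : ℝ≥0∞) ^ p x * volume I ^ (α * p x)) < ∞ := by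
  have hJfin : volume J ≠ ∞ := hJb.measure_lt_top.ne
  obtain ⟨s, P, hs, hP, hps, hpP⟩ := exists_real_bounds hp1 hp2
  have hp0 : ∀ x ∈ J, 0 < p x := fun x hx => by linarith [hps x hx]
  have hp1' : ∀ x ∈ J, 1 ≤ p x := fun x hx => by linarith [hps x hx]
  obtain ⟨D, hD0, hD⟩ := hp.abs_sub_mul_abs_log_le hJfin hP (fun x hx => (hp0 x hx).le) hpP
  set E : ℝ≥0∞ := ENNReal.ofReal (Real.exp D) with hEdef
  have hE1 : 1 ≤ E := by
    rw [hEdef, ENNReal.one_le_ofReal]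
    exact Real.one_le_exp hD0
  have hEt : E ≠ ∞ := ENNReal.ofReal_ne_top
  have hE0 : E ≠ 0 := (zero_lt_one.trans_le hE1).ne'
  set G : ℝ≥0∞ := (c + 1) * E
  have hG1 : 1 ≤ G := one_le_mul_of_one_le_of_one_le le_add_self hE1
  have hGt : G ≠ ∞ := ENNReal.mul_ne_top (by simp) hEt
  refine lt_of_le_of_lt (b := G ^ P * E) (iSup₂_le fun I hI => ?_)
    (ENNReal.mul_lt_top (ENNReal.rpow_lt_top_of_nonneg hP hGt) hEt.lt_top)
  have h0 := hI.volume_pos.ne'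
  have ht : volume I ≠ ∞ := ne_top_of_le_ne_top hJfin hI.volume_le
  obtain ⟨x₀, hx₀⟩ := hI.2.1.nonempty
  set q := p x₀
  have hq1 : 1 ≤ q := hp1' x₀ (hI.2.2 hx₀)
  have hq0 : 0 < q := by linarith
  have hcmp : ∀ x ∈ I, _ := fun x hx => rpow_div_le_mul h0 ht hq1 (hD I hI x hx x₀ hx₀)
  set V : ℝ≥0∞ := volume I
  set L : ℝ≥0∞ := E * V ^ (1 / q) with hLdef
  have hVq0 : V ^ (1 / q) ≠ 0 := by simp [ENNReal.rpow_eq_zero_iff, h0, ht]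
  have hVqt : V ^ (1 / q) ≠ ∞ := ENNReal.rpow_ne_top_of_nonneg (by positivity) ht
  have hL0 : L ≠ 0 := mul_ne_zero hE0 hVq0
  have hLt : L ≠ ∞ := ENNReal.mul_ne_top hEt hVqt
  have hind : ∀ r : ℝ≥0∞, modular p J (fun x => ‖I.indicator (1 : ℝ → ℝ) x‖ₑ / r) =
      ∫⁻ x in I, (r ^ p x)⁻¹ := by
    intro r
    calc modular p J (fun x => ‖I.indicator (1 : ℝ → ℝ) x‖ₑ / r)
        = ∫⁻ x in J, I.indicator (fun x => (r ^ p x)⁻¹) x := by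
          refine setLIntegral_congr_fun hJ.measurableSet fun x hx => ?_
          by_cases hxI : x ∈ I
          · simp [Set.indicator_of_mem hxI, ENNReal.inv_rpow]
          · simp [Set.indicator_of_notMem hxI, hp0 x hx]
      _ = _ := by rw [setLIntegral_indicator hI.measurableSet, Set.inter_eq_left.2 hI.2.2]
  -- On `I`, `L ^ p x ≥ E * V ^ (p x / q) ≥ V`, because `E ≥ 1` and `p x ≥ 1`.
  have hfL : modular p J (fun x => ‖I.indicator (1 : ℝ → ℝ) x‖ₑ / L) ≤ 1 := by
    rw [hind L]
    calc ∫⁻ x in I, (L ^ p x)⁻¹ ≤ ∫⁻ _ in I, V⁻¹ := by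
          refine setLIntegral_mono' hI.measurableSet fun x hx => ENNReal.inv_le_inv.2 ?_
          have hpx := hp1' x (hI.2.2 hx)
          refine (hcmp x hx).2.trans ?_
          rw [hLdef, ENNReal.mul_rpow_of_nonneg _ _ (by linarith), ← ENNReal.rpow_mul,
            one_div_mul_eq_div]
          gcongr
          simpa using ENNReal.rpow_le_rpow_of_exponent_le hE1 hpx
      _ = 1 := by rw [setLIntegral_const, ENNReal.inv_mul_cancel h0 ht]
  have hmem : MemVarLp p J (I.indicator 1) := by
    refine ⟨(measurable_one.indicator hI.measurableSet).aemeasurable, ?_⟩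
    have := hind 1
    simp only [div_one, ENNReal.one_rpow, inv_one, setLIntegral_const, one_mul] at this
    rw [this]
    exact ht.lt_top
  have hnorm : luxNorm p J (fun x => ‖I.indicator (1 : ℝ → ℝ) x‖ₑ) ≤ L := by
    have h := luxNorm_le (p := p) (J := J) (g := fun x => ‖I.indicator (1 : ℝ → ℝ) x‖ₑ)
      (ENNReal.toNNReal_pos hL0 hLt) (by rwa [ENNReal.coe_toNNReal hLt])
    rwa [ENNReal.coe_toNNReal hLt] at h
  -- Using `c + 1` makes the inequality strict, since the infimum in the norm need not be attained,
  -- and keeps the divisor nonzero when `c = 0`.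
  have hlt : luxNorm p J (fun x => (v x : ℝ≥0∞) * fracMaximal J α (I.indicator 1) x) <
      (c + 1) * L := by
    refine ((hc _ hmem).trans (mul_le_mul_right hnorm _)).trans_lt ?_
    rw [add_mul, one_mul]
    exact ENNReal.lt_add_right (ENNReal.mul_ne_top ENNReal.coe_ne_top hLt) hL0
  have hmod := modular_div_le_one_of_luxNorm_lt hJ (fun x hx => (hp0 x hx).le) hlt
  have hM0 : (c + 1) * L ≠ 0 := mul_ne_zero (by simp) hL0
  have hMt : (c + 1) * L ≠ ∞ := ENNReal.mul_ne_top (by simp) hLt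
  rw [ENNReal.inv_mul_le_iff h0 ht]
  calc ∫⁻ x in I, (v x : ℝ≥0∞) ^ p x * V ^ (α * p x)
      ≤ ∫⁻ x in I, G ^ P * E * V *
        (v x * fracMaximal J α (I.indicator 1) x / ((c + 1) * L)) ^ p x := by
        refine setLIntegral_mono' hI.measurableSet fun x hx => ?_
        have hpx := hp0 x (hI.2.2 hx)
        have hMp : ((c + 1) * L) ^ p x ≤ G ^ P * E * V := by
          calc ((c + 1) * L) ^ p x = G ^ p x * V ^ (p x / q) := by
                rw [hLdef, ← mul_assoc, ENNReal.mul_rpow_of_nonneg _ _ hpx.le, ← ENNReal.rpow_mul,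
                  one_div_mul_eq_div]
            _ ≤ G ^ P * (E * V) := by
                gcongr
                · exact hpP x (hI.2.2 hx)
                · exact (hcmp x hx).1
            _ = _ := by ring
        calc (v x : ℝ≥0∞) ^ p x * V ^ (α * p x) = (v x * V ^ α) ^ p x := by
              rw [ENNReal.mul_rpow_of_nonneg _ _ hpx.le, ENNReal.rpow_mul]
          _ ≤ (v x * fracMaximal J α (I.indicator 1) x) ^ p x := by
              gcongr
              exact volume_rpow_le_fracMaximal_indicator hI ht α hx
          _ = ((c + 1) * L * (v x * fracMaximal J α (I.indicator 1) x / ((c + 1) * L))) ^ p x := by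
              rw [ENNReal.mul_div_cancel hM0 hMt]
          _ ≤ _ := by
              rw [ENNReal.mul_rpow_of_nonneg _ _ hpx.le]
              gcongr
    _ = G ^ P * E * V *
        ∫⁻ x in I, (v x * fracMaximal J α (I.indicator 1) x / ((c + 1) * L)) ^ p x :=
        lintegral_const_mul' _ _ (ENNReal.mul_ne_top (ENNReal.mul_ne_top
          (ENNReal.rpow_ne_top_of_nonneg hP hGt) hEt) ht)
    _ ≤ G ^ P * E * V * 1 := by
        gcongr
        exact (lintegral_mono_set hI.2.2).trans hmod
    _ = V * (G ^ P * E) := by ring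

end VarExp

theorem corollary1p1 (J : Set ℝ) (hJ : J.OrdConnected) (hJb : Bornology.IsBounded J)
    (p : ℝ → ℝ) (hp1 : 1 < VarExp.expMinus p J) (hp2 : VarExp.expPlus p J < ⊤)
    (hp : VarExp.LogHolderOn p J)
    (α : ℝ) (hα0 : 0 ≤ α) (hα1 : α < 1)
    (v : ℝ → ℝ≥0) (hv : AEMeasurable v (volume.restrict J)) :
    (∃ c : ℝ≥0, ∀ f : ℝ → ℝ, VarExp.MemVarLp p J f →
      VarExp.luxNorm p J (fun x => (v x : ℝ≥0∞) * VarExp.fracMaximal J α f x) ≤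
        (c : ℝ≥0∞) * VarExp.luxNorm p J (fun x => ‖f x‖ₑ)) ↔
    (⨆ (I : Set ℝ) (_ : VarExp.IsSubinterval I J),
      (volume I)⁻¹ * ∫⁻ x in I, (v x : ℝ≥0∞) ^ p x * volume I ^ (α * p x)) < ∞ := by
  constructor
  · rintro ⟨c, hc⟩
    exact VarExp.iSup_lt_top_of_trace_inequality hJ hJb hp1 hp2 hp hc
  · exact VarExp.trace_inequality_of_iSup_lt_top hJ hJb hp1 hp2 hp hα0 hv
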